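/- Let $\mathbb{A}=(a_{ij})_{i,j\in I}$, $I=\{1,\dots,n\}$, be a symmetrizable generalized Cartan matrix: an integer matrix with $a_{ii}=2$, $a_{ij}\le 0$ for $i\ne j$, $a_{ij}=0$ if and only if $a_{ji}=0$, and $\mathbb{A}=DB$ with $D$ a real diagonal and $B$ a real symmetric matrix. Let $\Lambda$ be a free $\mathbb{Z}$-module of finite rank $d$ with dual $\Lambda^\vee$, and let $\alpha_1,\dots,\alpha_n\in\Lambda$ and $\alpha_1^\vee,\dots,\alpha_n^\vee\in\Lambda^\vee$ be two linearly independent families with $\langle\alpha_j,\alpha_i^\vee\rangle=a_{ij}$ for all $i,j\in I$ (a free and cofree Kac–Moody root datum). Put $\mathfrak{a}:=\Lambda^\vee\otimes_{\mathbb{Z}}\mathbb{R}$, extend $\alpha_1^\vee,\dots,\alpha_n^\vee$ to an $\mathbb{R}$-basis $\{\alpha_1^\vee,\dots,\alpha_n^\vee,h_{n+1},\dots,h_d\}$ of $\mathfrak{a}$, and let $\{\omega_1,\dots,\omega_n,\phi_{n+1},\dots,\phi_d\}\subset\mathfrak{a}^*$ be the dual basis. Let $W$ be the Weyl group, i.e.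 the group with generators $s_i$ ($i\in I$) and relations $s_i^2=1$ and $(s_is_j)^{m_{ij}}=1$ for $i\neq j$, where $m_{ij}=2,3,4,6,\infty$ according as $a_{ij}a_{ji}=0,1,2,3$ or $\ge 4$ (no relation if $m_{ij}=\infty$), acting linearly on $\mathfrak{a}$ by $s_i(x)=x-\langle\alpha_i,x\rangle\alpha_i^\vee$. Let $C:=\{x\in\mathfrak{a}:\langle\alpha_i,x\rangle>0\ \text{for all } i\in I\}$ be the open fundamental chamber and, for $h\in\mathfrak{a}$, let $\Xi_h:=\operatorname{conv}(W\cdot h)$ be the convex hull of the $W$-orbit of $h$. If $h\in C$, then a point $h'\in\mathfrak{a}$ lies in $\Xi_h$ if and only if $$\begin{cases}\langle\omega_i,w(h')\rangle\le\langle\omega_i,h\rangle & \text{for all } w\in W \text{ and } i\in I,\\ \langle\phi_i,h'\rangle=\langle\phi_i,h\rangle & \text{for all } i\in\{n+1,\dots,d\}.\end{cases}$$ -/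

import Mathlib

open scoped TensorProduct

noncomputable section

/-- Generalized Cartan matrices. -/
structure IsGCM {ι : Type*} (A : Matrix ι ι ℤ) : Prop where
  diag : ∀ i, A i i = 2
  nonpos : ∀ i j, i ≠ j → A i j ≤ 0
  zero_iff : ∀ i j, A i j = 0 ↔ A j i = 0

/-- `A` is symmetrizable: `A = D * B` with `D` diagonal and `B` symmetric (over `ℝ`). -/
def IsSymmetrizable {ι : Type*} [Fintype ι] [DecidableEq ι] (A : Matrix ι ι ℤ) : Prop :=
  ∃ (D : ι → ℝ) (B : Matrix ι ι ℝ), B.IsSymm ∧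
    A.map (fun z : ℤ => (z : ℝ)) = Matrix.diagonal D * B

/-- The entry `m_{ij}` of the Coxeter matrix as a function of `a_{ij} a_{ji}`, for `i ≠ j`;
the value `0` stands for `∞`, as in `CoxeterMatrix`. -/
def coxeterEntry (p : ℤ) : ℕ :=
  if p = 0 then 2 else if p = 1 then 3 else if p = 2 then 4 else if p = 3 then 6 else 0

/-- The Coxeter matrix attached to a square integer matrix. -/
def coxeterMatrixOf {ι : Type*} [DecidableEq ι] (A : Matrix ι ι ℤ) : CoxeterMatrix ι where
  M := Matrix.of fun i j => if i = j then 1 else coxeterEntry (A i j * A j i)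
  isSymm := by
    ext i j
    simp only [Matrix.transpose_apply, Matrix.of_apply, eq_comm (a := j) (b := i),
      mul_comm (A j i)]
  diagonal := by simp
  off_diagonal := by
    intro i j hij
    simp only [Matrix.of_apply, if_neg hij, coxeterEntry]
    split_ifs <;> decide

/-- A Kac-Moody root datum `(ι, A, Λ, (c_i), (h_i))`, where the lattice `Λ` is a free `ℤ`-module of
finite rank, `c_i ∈ Λ`, `h_i ∈ Λ^∨` and `⟨c_j, h_i⟩ = a_{ij}`. -/
structure KacMoodyRootDatum (ι : Type*) [Fintype ι] (Λ : Type*) [AddCommGroup Λ]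
    [Module.Free ℤ Λ] [Module.Finite ℤ Λ] where
  A : Matrix ι ι ℤ
  isGCM : IsGCM A
  c : ι → Λ
  h : ι → Module.Dual ℤ Λ
  pairing : ∀ i j, h i (c j) = A i j

namespace KacMoodyRootDatum

variable {ι : Type*} [Fintype ι] {Λ : Type*} [AddCommGroup Λ]
  [Module.Free ℤ Λ] [Module.Finite ℤ Λ] (D : KacMoodyRootDatum ι Λ)

/-- The `c_i` are linearly independent. -/
def IsFree : Prop := LinearIndependent ℤ D.c

/-- The `h_i` are linearly independent. -/
def IsCofree : Prop := LinearIndependent ℤ D.h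

/-- The real Cartan subalgebra `𝔞 = ℝ ⊗ Λ^∨`. -/
abbrev Cartan (_ : KacMoodyRootDatum ι Λ) : Type _ := ℝ ⊗[ℤ] Module.Dual ℤ Λ

/-- The real-linear functional on `𝔞` given by `⟨l, ·⟩` for `l ∈ Λ`. -/
def functional (l : Λ) : Module.Dual ℝ D.Cartan :=
  Module.Dual.baseChange ℝ (Module.Dual.eval ℤ Λ l)

@[simp]
theorem functional_tmul (l : Λ) (r : ℝ) (x : Module.Dual ℤ Λ) :
    D.functional l (r ⊗ₜ[ℤ] x) = (x l : ℝ) * r := by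
  simp [functional]

/-- The simple root `α_i`, viewed as a functional on `𝔞`. -/
def root (i : ι) : Module.Dual ℝ D.Cartan := D.functional (D.c i)

/-- The simple coroot `α_i^∨`, viewed as an element of `𝔞`. -/
def coroot (i : ι) : D.Cartan := (1 : ℝ) ⊗ₜ[ℤ] D.h i

theorem root_coroot (i j : ι) : D.root j (D.coroot i) = (D.A i j : ℝ) := by
  simp [root, coroot, D.pairing]

/-- The simple reflection `x ↦ x - ⟨α_i, x⟩ α_i^∨` of `𝔞`. This is the dual of the reflection
`l ↦ l - ⟨l, h_i⟩ c_i` of `Λ`. -/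
def simpleReflection (i : ι) : Module.End ℝ D.Cartan :=
  Module.preReflection (D.coroot i) (D.root i)

theorem simpleReflection_apply (i : ι) (x : D.Cartan) :
    D.simpleReflection i x = x - D.root i x • D.coroot i := rfl

variable [DecidableEq ι]

/-- The Weyl group: the Coxeter group with generators `s_i` and relations
`(s_i s_j)^{m_{ij}} = 1`. -/
abbrev WeylGroup : Type _ := (coxeterMatrixOf D.A).Group

/-- The simple reflections of `𝔞` satisfy the defining relations of the Weyl group. -/
theorem isLiftable_simpleReflection :
    (coxeterMatrixOf D.A).IsLiftable D.simpleReflection := by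
  intro i j
  have key : ∀ v : D.Cartan, (D.simpleReflection i * D.simpleReflection j) v =
      v + ((D.A j i : ℝ) * D.root j v - D.root i v) • D.coroot i
        - D.root j v • D.coroot j := by
    intro v
    simp only [Module.End.mul_apply, simpleReflection_apply, map_sub, map_smul, root_coroot]
    module
  have hii : (D.A i i : ℝ) = 2 := by exact_mod_cast D.isGCM.diag i
  have hjj : (D.A j j : ℝ) = 2 := by exact_mod_cast D.isGCM.diag j
  by_cases hij : i = j
  · subst hij
    have : coxeterMatrixOf D.A i i = 1 := (coxeterMatrixOf D.A).diagonal i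
    rw [this, pow_one]
    refine LinearMap.ext fun v => ?_
    rw [key, hii, Module.End.one_apply]
    module
  · have hm : coxeterMatrixOf D.A i j = coxeterEntry (D.A i j * D.A j i) := by
      show (if i = j then 1 else coxeterEntry (D.A i j * D.A j i)) = _
      rw [if_neg hij]
    rw [hm]
    have h1 := D.isGCM.nonpos i j hij
    have h2 := D.isGCM.nonpos j i (Ne.symm hij)
    have h0 := D.isGCM.zero_iff i j
    generalize hp : D.A i j * D.A j i = p
    refine LinearMap.ext fun v => ?_
    unfold coxeterEntry
    split_ifs with c0 c1 c2 c3
    · have hb : D.A i j = 0 ∧ D.A j i = 0 := by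
        rcases mul_eq_zero.mp (hp.trans c0) with h | h
        · exact ⟨h, h0.mp h⟩
        · exact ⟨h0.mpr h, h⟩
      simp only [pow_succ, pow_zero, one_mul, Module.End.mul_apply (_ * _) (_ * _), key, map_add,
        map_sub, map_smul, root_coroot, hii, hjj, hb, smul_eq_mul, Module.End.one_apply]
      push_cast
      module
    on_goal 4 => rw [pow_zero]
    all_goals
      have hb : D.A i j = -1 ∧ D.A j i = -p ∨ D.A i j = -p ∧ D.A j i = -1 := by
        have e1 : D.A i j ≤ -1 := by
          rcases h1.lt_or_eq with h | h
          · omega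
          · exact absurd (by rw [← hp, h, zero_mul]) c0
        have e2 : D.A j i ≤ -1 := by
          rcases h2.lt_or_eq with h | h
          · omega
          · exact absurd (by rw [← hp, h, mul_zero]) c0
        have e3 : -3 ≤ D.A i j := by nlinarith
        have e4 : -3 ≤ D.A j i := by nlinarith
        generalize D.A i j = a at *
        generalize D.A j i = b at *
        interval_cases a <;> interval_cases b <;> omega
      clear h0 h1 h2 hm hp
      subst p
      rcases hb with hb | hb <;>
      · simp only [pow_succ, pow_zero, one_mul, Module.End.mul_apply (_ * _) (_ * _), key,
          map_add, map_sub, map_smul, root_coroot, hii, hjj, hb, smul_eq_mul,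
          Module.End.one_apply]
        push_cast
        module

/-- The linear representation of the Weyl group on `𝔞`, where the generator `s_i` acts by the
simple reflection. -/
def weylRep : Representation ℝ D.WeylGroup D.Cartan :=
  (coxeterMatrixOf D.A).toCoxeterSystem.lift
    ⟨D.simpleReflection, D.isLiftable_simpleReflection⟩

/-- The open fundamental chamber `C`. -/
def openChamber : Set D.Cartan := {x | ∀ i, 0 < D.root i x}

/-- `Ξ_h`, the convex hull of the Weyl group orbit of `h`. -/
def orbitHull (x : D.Cartan) : Set D.Cartan :=
  convexHull ℝ (Set.range fun w : D.WeylGroup => D.weylRep w x)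

end KacMoodyRootDatum

end

/-!
A point `x` of the closed chamber is moved by the Weyl group to points `x - ∑ cᵢ αᵢ^∨` with
`cᵢ ≥ 0`, because `w αᵢ^∨` is a nonnegative combination of simple coroots whenever `w sᵢ` is longer
than `w`. Hence the hull of `W h` lies in the convex, Weyl-invariant set `dominated h` of points all
of whose translates have this form with respect to `h`; the inequalities of the theorem describe
this set.

Conversely, a functional that is maximal over the orbit at `w h` is nonnegative on all `w αᵢ^∨`, so
its maximum over the orbit also bounds it on `dominated h`. By separation the hull is dense in
`dominated h`, and being convex it contains the interior. Infinite orbits are handled by perturbing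
the functional by the height `∑ cᵢ`, whose sublevel sets meet the orbit in finite sets.

It remains to move an arbitrary point of `dominated h` to the interior. A minimizer of the height
over the closure of its orbit is dominant. A dominant `h - ∑ cᵢ αᵢ^∨` with all `cᵢ > 0` is
interior: the simple roots vanishing at it span a root datum of finite type, since
`∑ uᵢ aᵢⱼ > 0` for the positive vector `u = c`, and a Weyl group element of this subdatum moves
`∑ uᵢ αᵢ^∨` to an antidominant point. If some `cᵢ` vanish, the same applies inside the face of the
orthant through `c`, and neighbouring points are reached by averaging with reflections.
-/

noncomputable section

open CoxeterSystem (alternatingWord alternatingWord_succ alternatingWord_succ')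
open scoped Topology

section CoxeterSystem

variable {B W : Type*} [Group W] {M : CoxeterMatrix B} (cs : CoxeterSystem M W)

theorem exists_eq_mul_wordProd_not_isRightDescent (S : Set B) (w : W) :
    ∃ (v : W) (L : List B), w = v * cs.wordProd L ∧ cs.length w = cs.length v + L.length ∧
      (∀ i ∈ L, i ∈ S) ∧ ∀ i ∈ S, ¬cs.IsRightDescent v i := by
  induction hn : cs.length w using Nat.strong_induction_on generalizing w with
  | _ n ih =>
  by_cases hw : ∀ i ∈ S, ¬cs.IsRightDescent w i
  · exact ⟨w, [], by simp, by simp [hn], by simp, hw⟩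
  push Not at hw
  obtain ⟨i, hiS, hi⟩ := hw
  obtain ⟨v, L, hwv, hlen, hL, hv⟩ := ih _ (hn ▸ id hi : cs.length (w * cs.simple i) < n) _ rfl
  rw [cs.isRightDescent_iff] at hi
  refine ⟨v, L ++ [i], ?_, by simp only [List.length_append, List.length_singleton]; omega,
    by simpa [or_imp, forall_and] using ⟨hL, hiS⟩, hv⟩
  rw [cs.wordProd_append, ← mul_assoc, ← hwv, cs.wordProd_singleton,
    cs.simple_mul_simple_cancel_right]

theorem not_isReduced_append_pair (L : List B) (i : B) : ¬cs.IsReduced (L ++ [i] ++ [i]) := by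
  intro h
  have hprod : cs.wordProd (L ++ [i] ++ [i]) = cs.wordProd L := by
    simp [cs.wordProd_append, cs.wordProd_cons]
  have hle := cs.length_wordProd_le L
  rw [CoxeterSystem.IsReduced, hprod] at h
  simp only [List.length_append, List.length_singleton] at h
  omega

theorem isReduced_append_singleton_of_length_mul {v : W} {L : List B} {i : B}
    (hlen : cs.length (v * cs.wordProd L) = cs.length v + L.length)
    (hi : ¬cs.IsRightDescent (v * cs.wordProd L) i) : cs.IsReduced (L ++ [i]) := by
  have hle := cs.length_wordProd_le (L ++ [i])
  have hge := cs.length_mul_le v (cs.wordProd (L ++ [i]))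
  rw [cs.not_isRightDescent_iff, mul_assoc, ← cs.wordProd_singleton, ← cs.wordProd_append] at hi
  simp only [CoxeterSystem.IsReduced, List.length_append, List.length_singleton] at hle ⊢
  omega

theorem eq_alternatingWord_of_isReduced_append_singleton {i j : B} {L : List B}
    (hL : ∀ k ∈ L, k = i ∨ k = j) (hred : cs.IsReduced (L ++ [i])) :
    L = alternatingWord i j L.length := by
  induction L using List.reverseRecOn generalizing i j with
  | nil => rfl
  | append_singleton L k ih =>
    obtain rfl | rfl := hL k (by simp)
    · exact absurd hred (not_isReduced_append_pair cs L k)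
    · have hred' : cs.IsReduced (L ++ [k]) := by
        simpa only [List.take_left] using hred.take (L ++ [k]).length
      have hL' := ih (fun l hl => (hL l (by simp [hl])).symm) hred'
      rw [List.length_append, List.length_singleton, alternatingWord_succ, ← hL',
        List.concat_eq_append]

end CoxeterSystem

section RankTwo

/-- The coefficients `(x, y)` in `w α_i^∨ = x α_i^∨ + y α_j^∨`, where `w = ⋯ s_i s_j` is the
alternating product with `n` factors, `a = a_{ij}` and `b = a_{ji}`. -/
def rankTwoCoeff (a b : ℤ) : ℕ → ℤ × ℤ
  | 0 => (1, 0)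
  | n + 1 =>
    let p := rankTwoCoeff a b n
    if Even n then (p.1, -p.2 - a * p.1) else (-p.1 - b * p.2, p.2)

theorem IsGCM.cases_of_mul_lt_four {ι : Type*} {A : Matrix ι ι ℤ} (hA : IsGCM A) {i j : ι}
    (hij : i ≠ j) (hlt : A i j * A j i < 4) :
    (A i j, A j i) ∈ ({(0, 0), (-1, -1), (-1, -2), (-2, -1), (-1, -3), (-3, -1)} :
      Finset (ℤ × ℤ)) := by
  have ha := hA.nonpos i j hij
  have hb := hA.nonpos j i hij.symm
  have hab := hA.zero_iff i j
  generalize A i j = a at *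
  generalize A j i = b at *
  obtain rfl | ha' := eq_or_ne a 0
  · simp [hab.1 rfl]
  have hb' : b ≠ 0 := fun h => ha' (hab.2 h)
  have ha_lt : a ≤ -1 := by omega
  have hb_lt : b ≤ -1 := by omega
  have ha_ge : -3 ≤ a := by nlinarith
  have hb_ge : -3 ≤ b := by nlinarith
  interval_cases a <;> interval_cases b <;> first | omega | decide

theorem rankTwoCoeff_nonneg_of_lt :
    ∀ p ∈ ({(0, 0), (-1, -1), (-1, -2), (-2, -1), (-1, -3), (-3, -1)} : Finset (ℤ × ℤ)),
      ∀ n < coxeterEntry (p.1 * p.2), 0 ≤ rankTwoCoeff p.1 p.2 n := by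
  decide

theorem coxeterEntry_ne_zero_of_lt {p : ℤ} (h0 : 0 ≤ p) (h4 : p < 4) : coxeterEntry p ≠ 0 := by
  interval_cases p <;> decide

/-- The last conjunct is the invariant that makes the induction work: the coefficient changed
last dominates the other one. -/
theorem rankTwoCoeff_nonneg_of_four_le {a b : ℤ} (ha : a ≤ 0) (hb : b ≤ 0) (hab : 4 ≤ a * b)
    (n : ℕ) :
    0 ≤ rankTwoCoeff a b n ∧
      if Even n then 2 * (rankTwoCoeff a b n).2 ≤ -a * (rankTwoCoeff a b n).1
      else 2 * (rankTwoCoeff a b n).1 ≤ -b * (rankTwoCoeff a b n).2 := by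
  induction n with
  | zero => simpa [rankTwoCoeff, Prod.le_def] using ha
  | succ n ih =>
    obtain ⟨⟨hx, hy⟩, hdom⟩ := ih
    simp only [rankTwoCoeff, Nat.even_add_one]
    generalize (rankTwoCoeff a b n).1 = x at *
    generalize (rankTwoCoeff a b n).2 = y at *
    simp only [Prod.fst_zero, Prod.snd_zero] at hx hy
    split_ifs at hdom ⊢
    · refine ⟨⟨hx, ?_⟩, ?_⟩
      · simp only [Prod.snd_zero]; linarith
      · nlinarith [mul_le_mul_of_nonneg_left hdom (neg_nonneg.2 hb),
          mul_le_mul_of_nonneg_right hab hx]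
    · refine ⟨⟨?_, hy⟩, ?_⟩
      · simp only [Prod.fst_zero]; linarith
      · nlinarith [mul_le_mul_of_nonneg_left hdom (neg_nonneg.2 ha),
          mul_le_mul_of_nonneg_right hab hy]

theorem IsGCM.rankTwoCoeff_nonneg {ι : Type*} {A : Matrix ι ι ℤ} (hA : IsGCM A) {i j : ι}
    (hij : i ≠ j) {n : ℕ}
    (hn : coxeterEntry (A i j * A j i) ≠ 0 → n < coxeterEntry (A i j * A j i)) :
    0 ≤ rankTwoCoeff (A i j) (A j i) n := by
  have ha := hA.nonpos i j hij
  have hb := hA.nonpos j i hij.symm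
  rcases lt_or_ge (A i j * A j i) 4 with hlt | hge
  · have hm := coxeterEntry_ne_zero_of_lt (mul_nonneg_of_nonpos_of_nonpos ha hb) hlt
    exact rankTwoCoeff_nonneg_of_lt _ (hA.cases_of_mul_lt_four hij hlt) n (hn hm)
  · exact (rankTwoCoeff_nonneg_of_four_le ha hb hge n).1

end RankTwo

theorem coxeterMatrixOf_apply_of_ne {ι : Type*} [DecidableEq ι] {A : Matrix ι ι ℤ} {i j : ι}
    (hij : i ≠ j) : coxeterMatrixOf A i j = coxeterEntry (A i j * A j i) :=
  if_neg hij

theorem finite_setOf_sum_mul_le {κ : Type*} [Fintype κ] {b : κ → ℝ} (hb : ∀ k, 0 < b k) (R : ℝ) :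
    {n : κ → ℕ | ∑ k, n k * b k ≤ R}.Finite := by
  classical
  refine (Set.finite_Iic fun k => ⌊R / b k⌋₊).subset fun n hn k => Nat.le_floor ?_
  rw [le_div_iff₀ (hb k)]
  exact (Finset.single_le_sum (f := fun k => n k * b k)
    (fun l _ => mul_nonneg (Nat.cast_nonneg _) (hb l).le) (Finset.mem_univ k)).trans hn

theorem exists_mem_closure_forall_sum_le {ι : Type*} [Fintype ι] {S : Set (ι → ℝ)}
    (hS : S.Nonempty) (hS_nonneg : S ⊆ Set.Ici 0) :
    ∃ c ∈ closure S, ∀ d ∈ closure S, ∑ i, c i ≤ ∑ i, d i := by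
  obtain ⟨c₀, hc₀⟩ := hS
  have hcont : Continuous fun d : ι → ℝ => ∑ i, d i := by fun_prop
  have hnonneg : closure S ⊆ Set.Ici 0 := closure_minimal hS_nonneg isClosed_Ici
  have hcompact : IsCompact (closure S ∩ {d | ∑ i, d i ≤ ∑ i, c₀ i}) :=
    (isCompact_Icc (a := 0) (b := fun _ => ∑ i, c₀ i)).of_isClosed_subset
      (isClosed_closure.inter (isClosed_le hcont continuous_const)) fun d ⟨hd, hle⟩ =>
        ⟨hnonneg hd, fun i => (Finset.single_le_sum (fun j _ => hnonneg hd j)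
          (Finset.mem_univ i)).trans hle⟩
  obtain ⟨c, ⟨hc, hc_le⟩, hmin⟩ :=
    hcompact.exists_isMinOn ⟨c₀, subset_closure hc₀, by simp⟩ hcont.continuousOn
  refine ⟨c, hc, fun d hd => ?_⟩
  obtain hle | hge := le_total (∑ i, d i) (∑ i, c₀ i)
  · exact hmin ⟨hd, hle⟩
  · exact hc_le.trans hge

section PositiveForms

open Matrix

variable {ι : Type*} [Fintype ι] {N : Matrix ι ι ℝ}

theorem sum_vecMul_div_mul_sq_le_dotProduct_mulVec (hN : N.IsSymm)
    (hoff : ∀ i j, i ≠ j → N i j ≤ 0) {u : ι → ℝ} (hu : ∀ i, 0 < u i) (c : ι → ℝ) :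
    ∑ j, (u ᵥ* N) j / u j * c j ^ 2 ≤ c ⬝ᵥ N *ᵥ c := by
  have hquad : c ⬝ᵥ N *ᵥ c = ∑ i, ∑ j, N i j * (c i * c j) := by
    simp only [dotProduct, mulVec, Finset.mul_sum]
    exact Finset.sum_congr rfl fun i _ => Finset.sum_congr rfl fun j _ => by ring
  have hdiag : ∑ j, (u ᵥ* N) j / u j * c j ^ 2 = ∑ i, ∑ j, N i j * (u i / u j * c j ^ 2) := by
    rw [Finset.sum_comm]
    simp only [dotProduct, vecMul, Finset.sum_div, Finset.sum_mul]
    exact Finset.sum_congr rfl fun i _ => Finset.sum_congr rfl fun j _ => by ring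
  have hdiag' : ∑ j, (u ᵥ* N) j / u j * c j ^ 2 = ∑ i, ∑ j, N i j * (u j / u i * c i ^ 2) := by
    rw [hdiag, Finset.sum_comm]
    simp only [hN.apply]
  have hterm : ∀ i j, N i j * (u i / u j * c j ^ 2) + N i j * (u j / u i * c i ^ 2) ≤
      2 * (N i j * (c i * c j)) := by
    intro i j
    have hi := (hu i).ne'
    have hj := (hu j).ne'
    obtain rfl | hij := eq_or_ne i j
    · field_simp
      linarith
    · have hsq : N i j * (u i / u j * c j ^ 2) + N i j * (u j / u i * c i ^ 2) -
          2 * (N i j * (c i * c j)) = N i j * (u i * u j * (c i / u i - c j / u j) ^ 2) := by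
        field_simp
        ring
      have := mul_nonpos_of_nonpos_of_nonneg (hoff i j hij)
        (mul_nonneg (mul_pos (hu i) (hu j)).le (sq_nonneg (c i / u i - c j / u j)))
      linarith
  have hsum := Finset.sum_le_sum fun i (_ : i ∈ Finset.univ) =>
    Finset.sum_le_sum fun j (_ : j ∈ Finset.univ) => hterm i j
  simp only [Finset.sum_add_distrib, ← Finset.mul_sum] at hsum
  linarith

theorem dotProduct_mulVec_add_single [DecidableEq ι] (hN : N.IsSymm) {c : ι → ℝ} {k : ι} {r : ℝ}
    (hr : r * N k k = -2 * (c ᵥ* N) k) :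
    (c + Pi.single k r) ⬝ᵥ N *ᵥ (c + Pi.single k r) = c ⬝ᵥ N *ᵥ c := by
  have hleft : c ⬝ᵥ N *ᵥ Pi.single k r = r * (c ᵥ* N) k := by
    rw [dotProduct_mulVec, dotProduct_single, mul_comm]
  have hright : Pi.single k r ⬝ᵥ N *ᵥ c = r * (c ᵥ* N) k := by
    rw [single_dotProduct, ← vecMul_transpose, hN.eq]
  have hself : Pi.single k r ⬝ᵥ N *ᵥ Pi.single k r = r * (r * N k k) := by
    simp
  rw [mulVec_add, add_dotProduct, dotProduct_add, dotProduct_add, hleft, hright, hself, hr]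
  ring

end PositiveForms

section Symmetrizer

open Matrix

variable {ι : Type*} {A : Matrix ι ι ℤ}

theorem IsGCM.neg_of_ne_zero (hA : IsGCM A) {i j : ι} (hij : i ≠ j) (h0 : A i j ≠ 0) :
    A i j < 0 :=
  (hA.nonpos i j hij).lt_of_ne h0

theorem IsGCM.exists_sum_row_pos [Fintype ι] (hA : IsGCM A) {u : ι → ℝ} (hu : ∀ i, 0 < u i)
    (huA : ∀ j, 0 < ∑ i, u i * A i j) {S : Finset ι} (hS : S.Nonempty) :
    ∃ i ∈ S, 0 < ∑ j ∈ S, A i j := by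
  by_contra! hrow
  have hcol : ∀ j ∈ S, 0 < ∑ i ∈ S, u i * A i j := fun j hj =>
    (huA j).trans_le <| Finset.sum_le_sum_of_subset_of_nonpos' S.subset_univ fun i _ hi =>
      mul_nonpos_of_nonneg_of_nonpos (hu i).le
        (mod_cast hA.nonpos i j (ne_of_mem_of_not_mem hj hi).symm)
  refine (Finset.sum_pos hcol hS).not_ge ?_
  rw [Finset.sum_comm]
  refine Finset.sum_nonpos fun i hi => ?_
  rw [← Finset.mul_sum]
  exact mul_nonpos_of_nonneg_of_nonpos (hu i).le (mod_cast hrow i hi)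

/-- Such an `i` is a leaf of the diagram of `S`, or isolated in it. -/
theorem IsGCM.eq_of_sum_row_pos [DecidableEq ι] (hA : IsGCM A) {S : Finset ι} {i j k : ι}
    (hi : i ∈ S) (hrow : 0 < ∑ j ∈ S, A i j) (hj : j ∈ S.erase i) (hk : k ∈ S.erase i)
    (hij : A i j ≠ 0) (hik : A i k ≠ 0) : j = k := by
  by_contra hjk
  have hle : ∀ l ∈ S.erase i, A i l ≤ 0 := fun l hl =>
    hA.nonpos i l (Finset.ne_of_mem_erase hl).symm
  have hpair : ∑ l ∈ S.erase i, A i l ≤ A i j + A i k := by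
    rw [← Finset.add_sum_erase _ _ hj]
    gcongr
    rw [← Finset.add_sum_erase _ _ (Finset.mem_erase.2 ⟨Ne.symm hjk, hk⟩), add_le_iff_nonpos_right]
    exact Finset.sum_nonpos fun l hl => hle l (Finset.mem_of_mem_erase (Finset.mem_of_mem_erase hl))
  rw [← Finset.add_sum_erase _ _ hi, hA.diag] at hrow
  have := (hle j hj).lt_of_ne hij
  have := (hle k hk).lt_of_ne hik
  omega

theorem IsGCM.exists_symmetrizer_insert (hA : IsGCM A) {S : Finset ι} {i : ι} {d : ι → ℝ}
    (hd : ∀ j, 0 < d j) (hi : i ∉ S)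
    (hleaf : ∀ j ∈ S, ∀ k ∈ S, A i j ≠ 0 → A i k ≠ 0 → j = k) :
    ∃ e : ℝ, 0 < e ∧ ∀ j ∈ S, A i j * d j = A j i * e := by
  by_cases hk : ∃ k ∈ S, A i k ≠ 0
  · obtain ⟨k, hkS, hk⟩ := hk
    have hne : i ≠ k := (ne_of_mem_of_not_mem hkS hi).symm
    have hik : (A i k : ℝ) < 0 := mod_cast hA.neg_of_ne_zero hne hk
    have hki : (A k i : ℝ) < 0 := mod_cast hA.neg_of_ne_zero hne.symm (mt (hA.zero_iff i k).2 hk)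
    refine ⟨A i k * d k / A k i, div_pos_of_neg_of_neg (mul_neg_of_neg_of_pos hik (hd k)) hki,
      fun j hj => ?_⟩
    by_cases hij : A i j = 0
    · simp [hij, (hA.zero_iff i j).1 hij]
    · rw [hleaf j hj k hkS hij hk, mul_div_cancel₀ _ hki.ne]
  · push Not at hk
    exact ⟨1, one_pos, fun j hj => by simp [hk j hj, (hA.zero_iff i j).1 (hk j hj)]⟩

/-- The diagram of a matrix of finite type is a forest, so that a symmetrizer can be built by
adding one leaf at a time. -/
theorem IsGCM.exists_symmetrizer [Fintype ι] (hA : IsGCM A) {u : ι → ℝ} (hu : ∀ i, 0 < u i)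
    (huA : ∀ j, 0 < ∑ i, u i * A i j) :
    ∃ d : ι → ℝ, (∀ i, 0 < d i) ∧ (of fun i j => (A i j : ℝ) * d j).IsSymm := by
  classical
  suffices H : ∀ S : Finset ι, ∃ d : ι → ℝ, (∀ i, 0 < d i) ∧
      ∀ i ∈ S, ∀ j ∈ S, A i j * d j = A j i * d i by
    obtain ⟨d, hd, hdA⟩ := H Finset.univ
    exact ⟨d, hd, IsSymm.ext fun i j => hdA j (Finset.mem_univ j) i (Finset.mem_univ i)⟩
  intro S
  induction S using Finset.strongInduction with
  | H S ih =>
  obtain rfl | hS := S.eq_empty_or_nonempty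
  · exact ⟨1, by simp, by simp⟩
  obtain ⟨i, hi, hrow⟩ := hA.exists_sum_row_pos hu huA hS
  obtain ⟨d, hd, hdS⟩ := ih _ (Finset.erase_ssubset hi)
  obtain ⟨e, he, heS⟩ := hA.exists_symmetrizer_insert hd (Finset.notMem_erase i S)
    fun j hj k hk => hA.eq_of_sum_row_pos hi hrow hj hk
  refine ⟨Function.update d i e, fun j => ?_, fun j hj k hk => ?_⟩
  · obtain rfl | hij := eq_or_ne i j
    · simpa using he
    · simpa [hij.symm] using hd j
  · obtain rfl | hij := eq_or_ne i j <;> obtain rfl | hik := eq_or_ne i k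
    · rfl
    · simpa [hik.symm] using heS k (Finset.mem_erase.2 ⟨hik.symm, hk⟩)
    · simpa [hij.symm] using (heS j (Finset.mem_erase.2 ⟨hij.symm, hj⟩)).symm
    · simpa [hij.symm, hik.symm] using
        hdS j (Finset.mem_erase.2 ⟨hij.symm, hj⟩) k (Finset.mem_erase.2 ⟨hik.symm, hk⟩)

end Symmetrizer

namespace KacMoodyRootDatum

variable {ι : Type*} [Fintype ι] {Λ : Type*} [AddCommGroup Λ]
  [Module.Free ℤ Λ] [Module.Finite ℤ Λ] (D : KacMoodyRootDatum ι Λ)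

section WeylGroup

variable [DecidableEq ι]

/-- The Weyl group with its defining Coxeter presentation. -/
abbrev coxeterSystem : CoxeterSystem (coxeterMatrixOf D.A) D.WeylGroup :=
  (coxeterMatrixOf D.A).toCoxeterSystem

theorem weylRep_simple (i : ι) : D.weylRep (D.coxeterSystem.simple i) = D.simpleReflection i :=
  D.coxeterSystem.lift_apply_simple _ i

theorem weylRep_mul_apply (v w : D.WeylGroup) (x : D.Cartan) :
    D.weylRep (v * w) x = D.weylRep v (D.weylRep w x) := by
  rw [map_mul, Module.End.mul_apply]

theorem weylRep_wordProd_cons (i : ι) (L : List ι) (x : D.Cartan) :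
    D.weylRep (D.coxeterSystem.wordProd (i :: L)) x =
      D.simpleReflection i (D.weylRep (D.coxeterSystem.wordProd L) x) := by
  rw [CoxeterSystem.wordProd_cons, weylRep_mul_apply, weylRep_simple]

theorem weylRep_alternatingWord_coroot (i j : ι) (n : ℕ) :
    D.weylRep (D.coxeterSystem.wordProd (alternatingWord i j n)) (D.coroot i) =
      (rankTwoCoeff (D.A i j) (D.A j i) n).1 • D.coroot i +
        (rankTwoCoeff (D.A i j) (D.A j i) n).2 • D.coroot j := by
  induction n with
  | zero => simp [alternatingWord, rankTwoCoeff]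
  | succ n ih =>
    rw [alternatingWord_succ', weylRep_wordProd_cons, ih]
    simp only [rankTwoCoeff, simpleReflection_apply, map_add, map_zsmul]
    split_ifs <;>
    · simp only [root_coroot, D.isGCM.diag, ← Int.cast_smul_eq_zsmul ℝ]
      push_cast
      module

theorem rankTwoCoeff_nonneg_of_isReduced {i j : ι} (hij : i ≠ j) {n : ℕ}
    (hred : D.coxeterSystem.IsReduced (alternatingWord j i (n + 1))) :
    0 ≤ rankTwoCoeff (D.A i j) (D.A j i) n := by
  refine D.isGCM.rankTwoCoeff_nonneg hij fun hm => ?_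
  rw [← coxeterMatrixOf_apply_of_ne hij, (coxeterMatrixOf D.A).symmetric] at hm ⊢
  by_contra! hge
  exact D.coxeterSystem.not_isReduced_alternatingWord j i hm (Nat.lt_succ_of_le hge) hred

theorem weylRep_coroot_mem_span_nat {w : D.WeylGroup} {i : ι}
    (hi : ¬D.coxeterSystem.IsRightDescent w i) :
    D.weylRep w (D.coroot i) ∈ Submodule.span ℕ (Set.range D.coroot) := by
  set cs := D.coxeterSystem
  induction hn : cs.length w using Nat.strong_induction_on generalizing w i with
  | _ n ih =>
  obtain rfl | hw := eq_or_ne w 1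
  · simpa using Submodule.subset_span (Set.mem_range_self i)
  obtain ⟨j, hj⟩ := cs.exists_rightDescent_of_ne_one hw
  have hij : i ≠ j := fun h => hi (h ▸ hj)
  obtain ⟨v, L, rfl, hlen, hL, hv⟩ := exists_eq_mul_wordProd_not_isRightDescent cs {i, j} w
  have hv_lt : cs.length v < n := by
    have hL_ne : L ≠ [] := by
      rintro rfl
      exact hv j (by simp) (by simpa using hj)
    have := List.length_pos_iff.2 hL_ne
    omega
  have hred := isReduced_append_singleton_of_length_mul cs hlen hi
  have hL_eq := eq_alternatingWord_of_isReduced_append_singleton cs hL hred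
  rw [hL_eq, ← List.concat_eq_append, ← alternatingWord_succ] at hred
  rw [weylRep_mul_apply, hL_eq, weylRep_alternatingWord_coroot]
  obtain ⟨hx, hy⟩ := D.rankTwoCoeff_nonneg_of_isReduced hij hred
  lift (rankTwoCoeff (D.A i j) (D.A j i) L.length).1 to ℕ using hx with x
  lift (rankTwoCoeff (D.A i j) (D.A j i) L.length).2 to ℕ using hy with y
  simp only [natCast_zsmul, map_add, map_nsmul]
  exact add_mem (Submodule.smul_mem _ x (ih _ hv_lt (hv i (by simp)) rfl))
    (Submodule.smul_mem _ y (ih _ hv_lt (hv j (by simp)) rfl))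

end WeylGroup

section Lowering

/-- The point `x - ∑ cᵢ αᵢ^∨`: coordinates, based at `x`, for the points that the Weyl group
can reach from `x`. -/
def lowering (x : D.Cartan) : (ι → ℝ) →ᵃ[ℝ] D.Cartan :=
  AffineMap.const ℝ (ι → ℝ) x - (Fintype.linearCombination ℝ D.coroot).toAffineMap

theorem lowering_apply (x : D.Cartan) (c : ι → ℝ) :
    D.lowering x c = x - ∑ i, c i • D.coroot i := rfl

@[simp]
theorem lowering_zero (x : D.Cartan) : D.lowering x 0 = x := by simp [lowering_apply]

theorem lowering_lowering (x : D.Cartan) (c d : ι → ℝ) :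
    D.lowering (D.lowering x c) d = D.lowering x (c + d) := by
  simp only [lowering_apply, Pi.add_apply, add_smul, Finset.sum_add_distrib, sub_sub]

theorem root_lowering (x : D.Cartan) (c : ι → ℝ) (j : ι) :
    D.root j (D.lowering x c) = D.root j x - ∑ i, c i * D.A i j := by
  simp only [lowering_apply, map_sub, map_sum, map_smul, root_coroot, smul_eq_mul]

@[fun_prop]
theorem continuous_root_lowering (x : D.Cartan) (j : ι) :
    Continuous fun c => D.root j (D.lowering x c) := by
  simp only [root_lowering]
  fun_prop

theorem root_le_root_lowering {x : D.Cartan} {c : ι → ℝ} (hc : 0 ≤ c) {j : ι}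
    (hj : c j = 0) : D.root j x ≤ D.root j (D.lowering x c) := by
  rw [root_lowering, le_sub_self_iff]
  refine Finset.sum_nonpos fun i _ => ?_
  obtain rfl | hij := eq_or_ne i j
  · simp [hj]
  · exact mul_nonpos_of_nonneg_of_nonpos (hc i) (mod_cast D.isGCM.nonpos i j hij)

variable [DecidableEq ι]

theorem lowering_single (x : D.Cartan) (j : ι) (r : ℝ) :
    D.lowering x (Pi.single j r) = x - r • D.coroot j := by
  simp [lowering_apply, Pi.single_apply, ite_smul]

theorem simpleReflection_eq_lowering (x : D.Cartan) (j : ι) :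
    D.simpleReflection j x = D.lowering x (Pi.single j (D.root j x)) := by
  rw [simpleReflection_apply, lowering_single]

theorem simpleReflection_lowering (x : D.Cartan) (c : ι → ℝ) (j : ι) :
    D.simpleReflection j (D.lowering x c) =
      D.lowering x (c + Pi.single j (D.root j (D.lowering x c))) := by
  rw [simpleReflection_eq_lowering, lowering_lowering]

theorem exists_weylRep_eq_lowering (w : D.WeylGroup) :
    ∃ n : ι → ι → ℕ, ∀ x, D.weylRep w x = D.lowering x fun i => ∑ j, n i j * D.root j x := by
  set cs := D.coxeterSystem
  induction hlen : cs.length w using Nat.strong_induction_on generalizing w with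
  | _ l ih =>
  obtain rfl | hw := eq_or_ne w 1
  · refine ⟨0, fun x => ?_⟩
    simp [lowering_apply]
  obtain ⟨j, hj⟩ := cs.exists_rightDescent_of_ne_one hw
  obtain ⟨n, hn⟩ := ih _ (hlen ▸ id hj : cs.length (w * cs.simple j) < l) _ rfl
  obtain ⟨m, hm⟩ := (Submodule.mem_span_range_iff_exists_fun ℕ).1
    (D.weylRep_coroot_mem_span_nat (cs.isRightDescent_iff_not_isRightDescent_mul.1 hj))
  refine ⟨fun i k => n i k + if k = j then m i else 0, fun x => ?_⟩
  have hcoeff : (fun i => ∑ k, ((n i k + if k = j then m i else 0 : ℕ) : ℝ) * D.root k x) =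
      (fun i => ∑ k, n i k * D.root k x) + fun i => m i * D.root j x := by
    ext i
    simp [add_mul, Finset.sum_add_distrib]
  have hsum : D.root j x • ∑ i, m i • D.coroot i = ∑ i, (m i * D.root j x) • D.coroot i := by
    simp only [Finset.smul_sum, ← Nat.cast_smul_eq_nsmul ℝ, smul_smul, mul_comm]
  calc D.weylRep w x = D.weylRep (w * cs.simple j) (D.simpleReflection j x) := by
        rw [← weylRep_simple, ← weylRep_mul_apply, cs.simple_mul_simple_cancel_right]
    _ = D.lowering x (fun i => ∑ k, n i k * D.root k x) - D.root j x • ∑ i, m i • D.coroot i := by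
        rw [simpleReflection_apply, map_sub, map_smul, hn, ← hm]
    _ = _ := by rw [hcoeff, ← lowering_lowering, hsum, ← lowering_apply]

/-- Linear coordinates on `𝔞` that extend the coordinates with respect to the simple coroots
from their span. -/
def IsCorootCoord (π : D.Cartan →ₗ[ℝ] ι → ℝ) : Prop :=
  ∀ j, π (D.coroot j) = Pi.single j 1

variable {D} {π : D.Cartan →ₗ[ℝ] ι → ℝ}

theorem IsCorootCoord.map_lowering (hπ : D.IsCorootCoord π) (x : D.Cartan) (c : ι → ℝ) :
    π (D.lowering x c) = π x - c := by
  rw [lowering_apply, map_sub, map_sum]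
  simp only [map_smul, hπ _, ← Pi.single_smul, smul_eq_mul, mul_one, Finset.univ_sum_single]

theorem IsCorootCoord.map_sub_lowering (hπ : D.IsCorootCoord π) (x : D.Cartan) (c : ι → ℝ) :
    π (x - D.lowering x c) = c := by
  rw [map_sub, hπ.map_lowering, sub_sub_cancel]

theorem IsCorootCoord.lowering_injective (hπ : D.IsCorootCoord π) (x : D.Cartan) :
    Function.Injective (D.lowering x) :=
  Function.LeftInverse.injective (g := fun y => π (x - y)) (hπ.map_sub_lowering x)

end Lowering

section Dominated

/-- The closed fundamental chamber. -/
def closedChamber : Set D.Cartan := {x | ∀ i, 0 ≤ D.root i x}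

theorem openChamber_subset_closedChamber : D.openChamber ⊆ D.closedChamber :=
  fun _ hx i => (hx i).le

variable [DecidableEq ι]

/-- The points all of whose Weyl group translates are of the form `h - ∑ cᵢ αᵢ^∨` with
`cᵢ ≥ 0`. -/
def dominated (h : D.Cartan) : Set D.Cartan :=
  {x | ∀ w, D.weylRep w x ∈ D.lowering h '' Set.Ici 0}

variable {D} {h x : D.Cartan}

theorem weylRep_mem_lowering_image (hx : x ∈ D.closedChamber) (w : D.WeylGroup) :
    D.weylRep w x ∈ D.lowering x '' Set.Ici 0 := by
  obtain ⟨n, hn⟩ := D.exists_weylRep_eq_lowering w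
  exact ⟨_, fun i => Finset.sum_nonneg fun j _ => mul_nonneg (Nat.cast_nonneg _) (hx j),
    (hn x).symm⟩

theorem lowering_mem_dominated {c : ι → ℝ} (hc : 0 ≤ c)
    (hx : D.lowering h c ∈ D.closedChamber) : D.lowering h c ∈ D.dominated h := by
  intro w
  obtain ⟨d, hd, hdw⟩ := weylRep_mem_lowering_image hx w
  exact ⟨c + d, add_nonneg hc hd, by rw [← hdw, lowering_lowering]⟩

theorem self_mem_dominated (hh : h ∈ D.closedChamber) : h ∈ D.dominated h := by
  rw [← D.lowering_zero h] at hh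
  simpa only [lowering_zero] using lowering_mem_dominated le_rfl hh

theorem weylRep_mem_dominated (hx : x ∈ D.dominated h) (w : D.WeylGroup) :
    D.weylRep w x ∈ D.dominated h := by
  intro v
  rw [← weylRep_mul_apply]
  exact hx (v * w)

theorem exists_nonneg_lowering_eq (hx : x ∈ D.dominated h) :
    ∃ c, 0 ≤ c ∧ D.lowering h c = x := by
  simpa using hx 1

variable (D h) in
theorem convex_dominated : Convex ℝ (D.dominated h) := by
  have : D.dominated h = ⋂ w, D.weylRep w ⁻¹' (D.lowering h '' Set.Ici 0) := by
    ext
    simp only [dominated, Set.mem_ofPred_eq, Set.mem_iInter, Set.mem_preimage]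
  rw [this]
  exact convex_iInter fun w => ((convex_Ici 0).affine_image _).linear_preimage _

theorem orbitHull_subset_dominated (hh : h ∈ D.closedChamber) : D.orbitHull h ⊆ D.dominated h :=
  convexHull_min (Set.range_subset_iff.2 (weylRep_mem_dominated (self_mem_dominated hh)))
    (convex_dominated D h)

theorem weylRep_mem_orbitHull (hx : x ∈ D.orbitHull h) (w : D.WeylGroup) :
    D.weylRep w x ∈ D.orbitHull h := by
  have himage : D.weylRep w x ∈ D.weylRep w '' D.orbitHull h := Set.mem_image_of_mem _ hx
  rw [orbitHull, LinearMap.image_convexHull] at himage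
  refine convexHull_mono ?_ himage
  rintro _ ⟨_, ⟨v, rfl⟩, rfl⟩
  exact ⟨w * v, weylRep_mul_apply D w v h⟩

theorem simpleReflection_mem_orbitHull (hx : x ∈ D.orbitHull h) (j : ι) :
    D.simpleReflection j x ∈ D.orbitHull h := by
  rw [← weylRep_simple]
  exact weylRep_mem_orbitHull hx _

theorem convex_preimage_orbitHull (x y : D.Cartan) :
    Convex ℝ (D.lowering x ⁻¹' D.orbitHull y) :=
  (convex_convexHull ℝ _).affine_preimage _

theorem weylRep_mem_orbitHull_self (h : D.Cartan) (w : D.WeylGroup) :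
    D.weylRep w h ∈ D.orbitHull h :=
  subset_convexHull ℝ _ (Set.mem_range_self w)

theorem self_mem_orbitHull (h : D.Cartan) : h ∈ D.orbitHull h := by
  simpa only [map_one, Module.End.one_apply] using weylRep_mem_orbitHull_self h 1

end Dominated

section Closure

variable [DecidableEq ι] {D} {h x : D.Cartan} {π : D.Cartan →ₗ[ℝ] ι → ℝ}

/-- A maximum of `F` over the orbit, attained at `w h`, forces `F (w αᵢ^∨) ≥ 0` by comparison
with the neighbour `w sᵢ h`. -/
theorem le_of_mem_dominated_of_forall_le (hh : h ∈ D.openChamber) {F : Module.Dual ℝ D.Cartan}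
    {w : D.WeylGroup} (hw : ∀ v, F (D.weylRep v h) ≤ F (D.weylRep w h))
    (hx : x ∈ D.dominated h) : F x ≤ F (D.weylRep w h) := by
  have hcoroot : ∀ i, 0 ≤ F (D.weylRep w (D.coroot i)) := by
    intro i
    have hi := hw (w * D.coxeterSystem.simple i)
    rw [weylRep_mul_apply, weylRep_simple, simpleReflection_apply, map_sub, map_smul, map_sub,
      map_smul, sub_le_self_iff] at hi
    exact nonneg_of_mul_nonneg_right hi (hh i)
  obtain ⟨c, hc, hcx⟩ := hx w⁻¹
  have hx_eq : x = D.weylRep w (D.lowering h c) := by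
    rw [hcx, Representation.self_inv_apply]
  rw [hx_eq, lowering_apply, map_sub, map_sub, map_sum, map_sum, sub_le_self_iff]
  refine Finset.sum_nonneg fun i _ => ?_
  rw [map_smul, map_smul]
  exact mul_nonneg (hc i) (hcoroot i)

theorem finite_orbit_inter_height_le (hh : h ∈ D.openChamber) (hπ : D.IsCorootCoord π) (R : ℝ) :
    (Set.range (fun w => D.weylRep w h) ∩ {y | ∑ i, π (h - y) i ≤ R}).Finite := by
  have hfin := finite_setOf_sum_mul_le (fun k : ι × ι => hh k.2) R
  refine (hfin.image fun n => D.lowering h fun i => ∑ j, n (i, j) * D.root j h).subset ?_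
  rintro _ ⟨⟨w, rfl⟩, hw⟩
  obtain ⟨n, hn⟩ := D.exists_weylRep_eq_lowering w
  refine ⟨fun k => n k.1 k.2, ?_, (hn h).symm⟩
  simpa only [hn h, Set.mem_ofPred_eq, hπ.map_sub_lowering, Fintype.sum_prod_type] using hw

theorem exists_forall_weylRep_le (hh : h ∈ D.openChamber) (hπ : D.IsCorootCoord π)
    (F : Module.Dual ℝ D.Cartan) {u ε : ℝ} (hε : 0 < ε)
    (hF : ∀ w, F (D.weylRep w h) ≤ u - ε * ∑ i, π (h - D.weylRep w h) i) :
    ∃ w, ∀ v, F (D.weylRep v h) ≤ F (D.weylRep w h) := by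
  have hone : D.weylRep 1 h = h := by rw [map_one, Module.End.one_apply]
  have hu : F h ≤ u := by simpa [hone] using hF 1
  have hfin := finite_orbit_inter_height_le hh hπ ((u - F h) / ε)
  have hmem : h ∈ Set.range (fun w => D.weylRep w h) ∩ {y | ∑ i, π (h - y) i ≤ (u - F h) / ε} :=
    ⟨⟨1, hone⟩, by simpa using div_nonneg (sub_nonneg.2 hu) hε.le⟩
  obtain ⟨_, ⟨⟨w, rfl⟩, -⟩, hw⟩ := Set.exists_max_image _ F hfin ⟨h, hmem⟩
  refine ⟨w, fun v => ?_⟩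
  by_cases hv : ∑ i, π (h - D.weylRep v h) i ≤ (u - F h) / ε
  · exact hw _ ⟨⟨v, rfl⟩, hv⟩
  · rw [not_le, div_lt_iff₀' hε] at hv
    linarith [hF v, hw h hmem]

/-- Separate a point of the left-hand side from the closed convex set on the right by a functional
`f`. Subtracting a small multiple of the height from `f` makes it attain its maximum over the
orbit while it still separates. -/
theorem preimage_dominated_subset_closure (hh : h ∈ D.openChamber) (hπ : D.IsCorootCoord π) :
    D.lowering h ⁻¹' D.dominated h ⊆ closure (D.lowering h ⁻¹' D.orbitHull h) := by
  intro c hc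
  by_contra hnot
  obtain ⟨f, u, hfu, huc⟩ := geometric_hahn_banach_closed_point
    (convex_preimage_orbitHull h h).closure isClosed_closure hnot
  have coord_orbit : ∀ w, 0 ≤ π (h - D.weylRep w h) ∧ f (π (h - D.weylRep w h)) < u := by
    intro w
    obtain ⟨d, hd, hdw⟩ :=
      weylRep_mem_lowering_image (D.openChamber_subset_closedChamber hh) w
    rw [← hdw, hπ.map_sub_lowering]
    exact ⟨hd, hfu d (subset_closure (by
      rw [Set.mem_preimage, hdw]; exact weylRep_mem_orbitHull_self h w))⟩
  obtain ⟨ε, hε, hεc⟩ := exists_pos_mul_lt (sub_pos.2 huc) (∑ i, c i)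
  let F : Module.Dual ℝ D.Cartan := ((ε • ∑ i, LinearMap.proj i) - f.toLinearMap) ∘ₗ π
  have F_eq : ∀ y, F y = F h + f (π (h - y)) - ε * ∑ i, π (h - y) i := by
    intro y
    simp only [F, LinearMap.comp_apply, LinearMap.sub_apply, LinearMap.smul_apply,
      LinearMap.sum_apply, LinearMap.proj_apply, map_sub, smul_eq_mul, Pi.sub_apply,
      Finset.sum_sub_distrib, ContinuousLinearMap.coe_coe]
    ring
  obtain ⟨w, hw⟩ := exists_forall_weylRep_le hh hπ F (u := F h + u) hε fun w => by
    rw [F_eq]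
    linarith [(coord_orbit w).2]
  have hle := le_of_mem_dominated_of_forall_le hh hw hc
  have hheight := mul_nonneg hε.le
    (Finset.sum_nonneg fun i (_ : i ∈ Finset.univ) => (coord_orbit w).1 i)
  rw [F_eq, F_eq (D.weylRep w h), hπ.map_sub_lowering] at hle
  linarith [(coord_orbit w).2]

theorem interior_preimage_orbitHull_nonempty (hh : h ∈ D.openChamber) :
    (interior (D.lowering h ⁻¹' D.orbitHull h)).Nonempty := by
  have hzero : (0 : ι → ℝ) ∈ D.lowering h ⁻¹' D.orbitHull h := by
    simpa using self_mem_orbitHull h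
  rw [(convex_preimage_orbitHull h h).interior_nonempty_iff_affineSpan_eq_top,
    AffineSubspace.affineSpan_eq_top_iff_vectorSpan_eq_top_of_nonempty ℝ _ _ ⟨0, hzero⟩,
    vectorSpan_eq_span_vsub_set_right ℝ hzero, eq_top_iff, ← (Pi.basisFun ℝ ι).span_eq,
    Submodule.span_le, Set.range_subset_iff]
  intro i
  have hi : D.root i h • (Pi.single i 1 : ι → ℝ) ∈ Submodule.span ℝ
      ((fun x => x -ᵥ (0 : ι → ℝ)) '' (D.lowering h ⁻¹' D.orbitHull h)) := by
    refine Submodule.subset_span ⟨_, ?_, sub_zero _⟩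
    rw [Set.mem_preimage, ← Pi.single_smul, smul_eq_mul, mul_one, ← simpleReflection_eq_lowering]
    exact simpleReflection_mem_orbitHull (self_mem_orbitHull h) i
  rw [Pi.basisFun_apply]
  exact (Submodule.smul_mem_iff _ (hh i).ne').1 hi

theorem interior_preimage_dominated_subset (hh : h ∈ D.openChamber) (hπ : D.IsCorootCoord π) :
    interior (D.lowering h ⁻¹' D.dominated h) ⊆ D.lowering h ⁻¹' D.orbitHull h := by
  calc interior (D.lowering h ⁻¹' D.dominated h)
      ⊆ interior (closure (D.lowering h ⁻¹' D.orbitHull h)) :=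
        interior_mono (preimage_dominated_subset_closure hh hπ)
    _ = interior (D.lowering h ⁻¹' D.orbitHull h) :=
        (convex_preimage_orbitHull h h).interior_closure_eq_interior_of_nonempty_interior
          (interior_preimage_orbitHull_nonempty hh)
    _ ⊆ D.lowering h ⁻¹' D.orbitHull h := interior_subset

end Closure

section FiniteType

open Matrix

theorem root_linearCombination_coroot (c : ι → ℝ) (j : ι) :
    D.root j (Fintype.linearCombination ℝ D.coroot c) = ∑ i, c i * D.A i j := by
  simp [Fintype.linearCombination_apply, root_coroot]

variable [DecidableEq ι]

theorem exists_weylRep_linearCombination_coroot_eq {d : ι → ℝ}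
    (hN : (of fun i j => D.A i j * d j).IsSymm) (v : ι → ℝ) (w : D.WeylGroup) :
    ∃ c, D.weylRep w (Fintype.linearCombination ℝ D.coroot v) =
        Fintype.linearCombination ℝ D.coroot c ∧
      c ⬝ᵥ of (fun i j => D.A i j * d j) *ᵥ c = v ⬝ᵥ of (fun i j => D.A i j * d j) *ᵥ v := by
  induction w using D.coxeterSystem.simple_induction_left with
  | one => exact ⟨v, by simp, rfl⟩
  | mul_simple_left w j ih =>
    obtain ⟨c, hc, hform⟩ := ih
    set r := D.root j (Fintype.linearCombination ℝ D.coroot c) with hr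
    refine ⟨c + Pi.single j (-r), ?_, ?_⟩
    · rw [weylRep_mul_apply, weylRep_simple, hc, simpleReflection_apply, map_add,
        Fintype.linearCombination_apply_single, neg_smul, sub_eq_add_neg]
    · have hsum : (c ᵥ* of fun i j => D.A i j * d j) j = r * d j := by
        rw [hr, root_linearCombination_coroot, Finset.sum_mul]
        exact Finset.sum_congr rfl fun i _ => (mul_assoc _ _ _).symm
      rw [dotProduct_mulVec_add_single hN, hform]
      rw [hsum, of_apply, D.isGCM.diag]
      push_cast
      ring

variable {D} {u : ι → ℝ}

theorem exists_forall_weylRep_linearCombination_coroot_le (hu : ∀ i, 0 < u i)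
    (huA : ∀ j, 0 < ∑ i, u i * D.A i j) (v : ι → ℝ) :
    ∃ R, ∀ w, ∃ c, D.weylRep w (Fintype.linearCombination ℝ D.coroot v) =
      Fintype.linearCombination ℝ D.coroot c ∧ ∀ j, |c j| ≤ R := by
  obtain ⟨d, hd, hN⟩ := D.isGCM.exists_symmetrizer hu huA
  set N : Matrix ι ι ℝ := of fun i j => D.A i j * d j
  have hoff : ∀ i j, i ≠ j → N i j ≤ 0 := fun i j hij =>
    mul_nonpos_of_nonpos_of_nonneg (mod_cast D.isGCM.nonpos i j hij) (hd j).le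
  have hpos : ∀ j, 0 < (u ᵥ* N) j / u j := fun j => by
    have hcol : (u ᵥ* N) j = (∑ i, u i * D.A i j) * d j := by
      rw [Finset.sum_mul]
      exact Finset.sum_congr rfl fun i _ => (mul_assoc _ _ _).symm
    rw [hcol]
    exact div_pos (mul_pos (huA j) (hd j)) (hu j)
  refine ⟨∑ j, √((v ⬝ᵥ N *ᵥ v) / ((u ᵥ* N) j / u j)), fun w => ?_⟩
  obtain ⟨c, hc, hform⟩ := D.exists_weylRep_linearCombination_coroot_eq hN v w
  refine ⟨c, hc, fun j => ?_⟩
  have hsq : (u ᵥ* N) j / u j * c j ^ 2 ≤ v ⬝ᵥ N *ᵥ v :=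
    calc (u ᵥ* N) j / u j * c j ^ 2 ≤ ∑ j, (u ᵥ* N) j / u j * c j ^ 2 :=
          Finset.single_le_sum (f := fun j => (u ᵥ* N) j / u j * c j ^ 2)
            (fun i _ => mul_nonneg (hpos i).le (sq_nonneg _)) (Finset.mem_univ j)
      _ ≤ c ⬝ᵥ N *ᵥ c := sum_vecMul_div_mul_sq_le_dotProduct_mulVec hN hoff hu c
      _ = v ⬝ᵥ N *ᵥ v := hform
  calc |c j| ≤ √((v ⬝ᵥ N *ᵥ v) / ((u ᵥ* N) j / u j)) :=
        Real.abs_le_sqrt ((le_div_iff₀' (hpos j)).2 hsq)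
    _ ≤ _ := Finset.single_le_sum (f := fun j => √((v ⬝ᵥ N *ᵥ v) / ((u ᵥ* N) j / u j)))
        (fun i _ => Real.sqrt_nonneg _) (Finset.mem_univ j)

theorem IsCorootCoord.apply_linearCombination_coroot {π : D.Cartan →ₗ[ℝ] ι → ℝ}
    (hπ : D.IsCorootCoord π) (c : ι → ℝ) : π (Fintype.linearCombination ℝ D.coroot c) = c := by
  have := hπ.map_sub_lowering 0 c
  rwa [lowering_apply, sub_sub_cancel, ← Fintype.linearCombination_apply] at this

/-- An orbit point of lowest height is antidominant. -/
theorem exists_weylRep_linearCombination_coroot_root_nonpos {π : D.Cartan →ₗ[ℝ] ι → ℝ}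
    (hπ : D.IsCorootCoord π) (hu : ∀ i, 0 < u i) (huA : ∀ j, 0 < ∑ i, u i * D.A i j) :
    ∃ w e, D.weylRep w (Fintype.linearCombination ℝ D.coroot u) =
      Fintype.linearCombination ℝ D.coroot e ∧
      ∀ j, D.root j (Fintype.linearCombination ℝ D.coroot e) ≤ 0 := by
  set y := Fintype.linearCombination ℝ D.coroot u
  have hy : y ∈ D.openChamber := fun j => by
    simpa only [y, root_linearCombination_coroot] using huA j
  obtain ⟨R, hR⟩ := exists_forall_weylRep_linearCombination_coroot_le hu huA u
  let height : Module.Dual ℝ D.Cartan := ∑ i, LinearMap.proj i ∘ₗ π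
  have height_apply : ∀ x, height x = ∑ i, π x i := fun x => by simp [height]
  have height_ge : ∀ w, -∑ _i : ι, R ≤ height (D.weylRep w y) := fun w => by
    obtain ⟨c, hc, hcR⟩ := hR w
    rw [height_apply, hc, hπ.apply_linearCombination_coroot, ← Finset.sum_neg_distrib]
    exact Finset.sum_le_sum fun i _ => neg_le_of_abs_le (hcR i)
  obtain ⟨w, hw⟩ := exists_forall_weylRep_le hy hπ (-height) one_pos
    (u := 2 * ∑ _i : ι, R + height y) fun w => by
      rw [LinearMap.neg_apply, ← height_apply, map_sub]
      linarith [height_ge w]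
  obtain ⟨e, he, -⟩ := hR w
  refine ⟨w, e, he, fun j => ?_⟩
  have hle := hw (D.coxeterSystem.simple j * w)
  have hcoroot : height (D.coroot j) = 1 := by
    rw [height_apply, hπ j]
    simp
  rw [weylRep_mul_apply, weylRep_simple, simpleReflection_apply, LinearMap.neg_apply,
    LinearMap.neg_apply, map_sub, map_smul, hcoroot, he] at hle
  simp only [smul_eq_mul] at hle
  linarith

end FiniteType

section Restrict

/-- The root datum with the same lattice whose simple roots and coroots are those indexed
by `J`. -/
def restrict (J : Finset ι) : KacMoodyRootDatum J Λ where
  A := D.A.submatrix (↑) (↑)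
  isGCM :=
    { diag := fun i => D.isGCM.diag i
      nonpos := fun i j hij => D.isGCM.nonpos i j (Subtype.coe_ne_coe.2 hij)
      zero_iff := fun i j => D.isGCM.zero_iff i j }
  c i := D.c i
  h i := D.h i
  pairing i j := D.pairing i j

variable (J : Finset ι)

theorem coroot_restrict (j : J) : (D.restrict J).coroot j = D.coroot j := rfl

theorem simpleReflection_restrict (j : J) :
    (D.restrict J).simpleReflection j = D.simpleReflection j := rfl

theorem lowering_extend (x : D.Cartan) (c : J → ℝ) :
    D.lowering x (Function.extend Subtype.val c 0) = (D.restrict J).lowering x c := by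
  have hsum : ∑ i, Function.extend Subtype.val c 0 i • D.coroot i =
      ∑ i ∈ J, Function.extend Subtype.val c 0 i • D.coroot i := by
    refine (Finset.sum_subset J.subset_univ fun i _ hi => ?_).symm
    rw [Function.extend_apply' _ _ _ (by simpa using hi), Pi.zero_apply, zero_smul]
  simp only [lowering_apply, hsum, coroot_restrict, ← Finset.sum_coe_sort J,
    Subtype.val_injective.extend_apply]

theorem lowering_indicator (x : D.Cartan) (c : ι → ℝ) :
    D.lowering x ((J : Set ι).indicator c) = (D.restrict J).lowering x fun j => c j := by
  rw [← lowering_extend]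
  congr 1
  ext i
  by_cases hi : i ∈ J
  · rw [Set.indicator_of_mem (by simpa using hi)]
    exact (Subtype.val_injective.extend_apply (fun j : J => c j) 0 ⟨i, hi⟩).symm
  · rw [Set.indicator_of_notMem (by simpa using hi),
      Function.extend_apply' _ _ _ (by simpa using hi), Pi.zero_apply]

theorem lowering_add_smul_extend (x : D.Cartan) (c : ι → ℝ) (δ : ℝ) (e : J → ℝ) :
    D.lowering x (c + δ • Function.extend Subtype.val e 0) =
      D.lowering x c - δ • Fintype.linearCombination ℝ (D.restrict J).coroot e := by
  have hsmul : δ • Function.extend Subtype.val e (0 : ι → ℝ) =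
      Function.extend Subtype.val (δ • e) 0 := by
    rw [← Function.extend_smul, smul_zero]
  rw [← lowering_lowering, hsmul, lowering_extend, ← map_smul]
  rfl

variable [DecidableEq ι]

theorem weylRep_eq_self {x : D.Cartan} (hx : ∀ j, D.root j x = 0) (w : D.WeylGroup) :
    D.weylRep w x = x := by
  induction w using D.coxeterSystem.simple_induction_left with
  | one => simp
  | mul_simple_left w j ih =>
    rw [weylRep_mul_apply, ih, weylRep_simple, simpleReflection_apply, hx, zero_smul, sub_zero]

theorem exists_weylRep_eq_weylRep_restrict (w : (D.restrict J).WeylGroup) :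
    ∃ v, D.weylRep v = (D.restrict J).weylRep w := by
  induction w using (D.restrict J).coxeterSystem.simple_induction_left with
  | one => exact ⟨1, by simp only [map_one]⟩
  | mul_simple_left w j ih =>
    obtain ⟨v, hv⟩ := ih
    exact ⟨D.coxeterSystem.simple j * v, by
      rw [map_mul, map_mul, hv, weylRep_simple, weylRep_simple, simpleReflection_restrict]⟩

theorem orbitHull_restrict_subset (x : D.Cartan) :
    (D.restrict J).orbitHull x ⊆ D.orbitHull x := by
  refine convexHull_mono ?_
  rintro _ ⟨w, rfl⟩
  obtain ⟨v, hv⟩ := D.exists_weylRep_eq_weylRep_restrict J w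
  exact ⟨v, LinearMap.congr_fun hv x⟩

variable {D} in
theorem IsCorootCoord.restrict {π : D.Cartan →ₗ[ℝ] ι → ℝ} (hπ : D.IsCorootCoord π) :
    (D.restrict J).IsCorootCoord (LinearMap.funLeft ℝ ℝ (↑) ∘ₗ π) := by
  intro j
  ext i
  rw [LinearMap.comp_apply, coroot_restrict, hπ, LinearMap.funLeft_apply]
  simp only [Pi.single_apply, Subtype.ext_iff]

end Restrict

section InteriorPoints

variable {D} {h : D.Cartan} {c : ι → ℝ}

theorem eventually_pos_and_root_lowering_pos (hc : ∀ i, 0 < c i)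
    (hx : D.lowering h c ∈ D.closedChamber) :
    ∀ᶠ d in 𝓝 c, (∀ i, 0 < d i) ∧
      ∀ j, D.root j (D.lowering h c) ≠ 0 → 0 < D.root j (D.lowering h d) := by
  refine .and (Filter.eventually_all.2 fun i => ?_) (Filter.eventually_all.2 fun j => ?_)
  · exact (continuous_apply i).continuousAt.eventually_const_lt (hc i)
  · by_cases hj : D.root j (D.lowering h c) = 0
    · simp [hj]
    · filter_upwards [(D.continuous_root_lowering h j).continuousAt.eventually_const_lt
        ((hx j).lt_of_ne' hj)] with d hd _ using hd

theorem sum_restrict_pos (hh : h ∈ D.openChamber) (hc : 0 ≤ c) {J : Finset ι}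
    (hJ : ∀ j ∈ J, D.root j (D.lowering h c) ≤ 0) (j : J) :
    0 < ∑ i : J, c i * (D.restrict J).A i j := by
  classical
  have hroot := hJ j j.2
  have houter : ∑ i ∈ Jᶜ, c i * (D.A i j : ℝ) ≤ 0 := Finset.sum_nonpos fun i hi =>
    mul_nonpos_of_nonneg_of_nonpos (hc i) <| mod_cast D.isGCM.nonpos i j <|
      (ne_of_mem_of_not_mem j.2 (Finset.mem_compl.1 hi)).symm
  rw [root_lowering, ← Finset.sum_add_sum_compl J] at hroot
  rw [show ∑ i : J, c i * ((D.restrict J).A i j : ℝ) = ∑ i ∈ J, c i * (D.A i j : ℝ) from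
    Finset.sum_coe_sort J fun i => c i * (D.A i j : ℝ)]
  linarith [hh j]

variable [DecidableEq ι]

theorem mem_interior_preimage_dominated_of_pos (hc : ∀ i, 0 < c i)
    (hx : D.lowering h c ∈ D.openChamber) :
    c ∈ interior (D.lowering h ⁻¹' D.dominated h) := by
  rw [mem_interior_iff_mem_nhds]
  filter_upwards [eventually_pos_and_root_lowering_pos hc (D.openChamber_subset_closedChamber hx)]
    with d ⟨hd, hroot⟩
  exact lowering_mem_dominated (fun i => (hd i).le) fun j => (hroot j (hx j).ne').le

/-- An element of the stabilizer of `lowering h c` moves the direction `c` restricted to the walls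
through this point into the closed chamber. -/
theorem exists_pos_add_smul_mem_dominated {π : D.Cartan →ₗ[ℝ] ι → ℝ} (hh : h ∈ D.openChamber)
    (hπ : D.IsCorootCoord π) (hc : ∀ i, 0 < c i) (hx : D.lowering h c ∈ D.closedChamber)
    {J : Finset ι} (hJ : ∀ j, j ∈ J ↔ D.root j (D.lowering h c) = 0) :
    ∃ δ > 0, D.lowering h (c + (δ : ℝ) • Function.extend Subtype.val (fun j : J => c j) 0) ∈
      D.dominated h := by
  obtain ⟨w, e, hwe, he⟩ := exists_weylRep_linearCombination_coroot_root_nonpos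
    (hπ.restrict J) (fun j : J => hc j)
    (sum_restrict_pos (J := J) hh (fun i => (hc i).le) fun j hj => ((hJ j).1 hj).le)
  have htendsto : Filter.Tendsto (fun δ : ℝ => c + δ • Function.extend Subtype.val e 0)
      (𝓝[>] 0) (𝓝 c) :=
    ((by fun_prop : Continuous _).tendsto' 0 c (by simp)).mono_left nhdsWithin_le_nhds
  obtain ⟨δ, ⟨hcoord, hroot⟩, hδ⟩ := ((htendsto.eventually
    (eventually_pos_and_root_lowering_pos hc hx)).and self_mem_nhdsWithin).exists
  refine ⟨δ, hδ, ?_⟩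
  obtain ⟨v, hv⟩ := D.exists_weylRep_eq_weylRep_restrict J w
  have hfix : (D.restrict J).weylRep w (D.lowering h c) = D.lowering h c :=
    (D.restrict J).weylRep_eq_self (fun j => (hJ j).1 j.2) w
  have hmove : D.weylRep v
        (D.lowering h (c + δ • Function.extend Subtype.val (fun j : J => c j) 0)) =
      D.lowering h (c + δ • Function.extend Subtype.val e 0) := by
    rw [hv, lowering_add_smul_extend, lowering_add_smul_extend, map_sub, map_smul, hwe, hfix]
  have hmem : D.lowering h (c + δ • Function.extend Subtype.val e 0) ∈ D.dominated h := by
    refine lowering_mem_dominated (fun i => (hcoord i).le) fun j => ?_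
    by_cases hj : D.root j (D.lowering h c) = 0
    · rw [lowering_add_smul_extend, map_sub, hj, map_smul, smul_eq_mul, zero_sub]
      exact neg_nonneg.2 (mul_nonpos_of_nonneg_of_nonpos (le_of_lt hδ) (he ⟨j, (hJ j).2 hj⟩))
    · exact (hroot j hj).le
  rw [← hmove] at hmem
  simpa only [Representation.inv_self_apply] using weylRep_mem_dominated hmem v⁻¹

theorem exists_pos_sub_smul_mem_interior (hh : h ∈ D.openChamber) (hc : ∀ i, 0 < c i)
    (hx : D.lowering h c ∈ D.closedChamber)
    {J : Finset ι} (hJ : ∀ j, j ∈ J ↔ D.root j (D.lowering h c) = 0) :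
    ∃ δ > 0, c - (δ : ℝ) • Function.extend Subtype.val (fun j : J => c j) 0 ∈
      interior (D.lowering h ⁻¹' D.dominated h) := by
  set u := Function.extend Subtype.val (fun j : J => c j) 0
  have htendsto : Filter.Tendsto (fun δ : ℝ => c - δ • u) (𝓝[>] 0) (𝓝 c) :=
    ((by fun_prop : Continuous _).tendsto' 0 c (by simp)).mono_left nhdsWithin_le_nhds
  obtain ⟨δ, ⟨hcoord, hroot⟩, hδ⟩ := ((htendsto.eventually
    (eventually_pos_and_root_lowering_pos hc hx)).and self_mem_nhdsWithin).exists
  refine ⟨δ, hδ, mem_interior_preimage_dominated_of_pos hcoord fun j => ?_⟩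
  by_cases hj : D.root j (D.lowering h c) = 0
  · have hsum := sum_restrict_pos hh (fun i => (hc i).le) (fun j hj => ((hJ j).1 hj).le)
      ⟨j, (hJ j).2 hj⟩
    rw [sub_eq_add_neg, ← neg_smul, lowering_add_smul_extend, map_sub, hj, map_smul, smul_eq_mul,
      zero_sub, neg_mul, neg_neg]
    refine mul_pos hδ ?_
    rwa [← root_linearCombination_coroot (D.restrict J) (fun i => c i) ⟨j, (hJ j).2 hj⟩] at hsum
  · exact hroot j hj

theorem mem_interior_preimage_dominated {π : D.Cartan →ₗ[ℝ] ι → ℝ} (hh : h ∈ D.openChamber)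
    (hπ : D.IsCorootCoord π) (hc : ∀ i, 0 < c i) (hx : D.lowering h c ∈ D.closedChamber) :
    c ∈ interior (D.lowering h ⁻¹' D.dominated h) := by
  classical
  obtain ⟨J, hJ⟩ : ∃ J : Finset ι, ∀ j, j ∈ J ↔ D.root j (D.lowering h c) = 0 :=
    ⟨Finset.univ.filter _, Finset.mem_filter_univ⟩
  obtain ⟨δ, hδ, hadd⟩ := exists_pos_add_smul_mem_dominated hh hπ hc hx hJ
  obtain ⟨ε, hε, hsub⟩ := exists_pos_sub_smul_mem_interior hh hc hx hJ
  refine Convex.openSegment_interior_self_subset_interior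
    ((convex_dominated D h).affine_preimage (D.lowering h)) hsub hadd
    ⟨δ / (δ + ε), ε / (δ + ε), by positivity, by positivity, by field_simp, ?_⟩
  ext i
  simp only [Pi.add_apply, Pi.sub_apply, Pi.smul_apply, smul_eq_mul]
  field_simp
  ring

end InteriorPoints

variable [DecidableEq ι] {D} {h x y : D.Cartan} {π : D.Cartan →ₗ[ℝ] ι → ℝ} {c : ι → ℝ}

section Faces

variable {J : Finset ι}

theorem eventually_lowering_indicator_mem_orbitHull (hh : h ∈ D.openChamber)
    (hπ : D.IsCorootCoord π) (hc : ∀ j ∈ J, 0 < c j) (hcJ : ∀ j ∉ J, c j = 0)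
    (hx : D.lowering h c ∈ D.closedChamber) :
    ∀ᶠ d in 𝓝 c, D.lowering h ((J : Set ι).indicator d) ∈ D.orbitHull h := by
  have hx' : (D.restrict J).lowering h (fun j => c j) ∈ (D.restrict J).closedChamber := fun j => by
    rw [← lowering_indicator, Set.indicator_eq_self.2 fun i hi => not_imp_comm.1 (hcJ i) hi]
    exact hx j
  have hinterior := mem_interior_preimage_dominated (D := D.restrict J) (fun j => hh j)
    (hπ.restrict J) (fun j => hc j j.2) hx'
  have hcont : Continuous fun (d : ι → ℝ) (j : J) => d j := by fun_prop
  filter_upwards [hcont.continuousAt (isOpen_interior.mem_nhds hinterior)] with d hd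
  rw [lowering_indicator]
  exact D.orbitHull_restrict_subset J h
    (interior_preimage_dominated_subset (D := D.restrict J) (fun j => hh j) (hπ.restrict J) hd)

theorem lowering_mul_root_mem_orbitHull (hy : y ∈ D.orbitHull h) {t : ι → ℝ} (ht : 0 ≤ t)
    (hsum : ∑ j, t j ≤ 1) : D.lowering y (fun j => t j * D.root j y) ∈ D.orbitHull h := by
  have hcomb : D.lowering y (fun j => t j * D.root j y) =
      ∑ o : Option ι, o.elim (1 - ∑ j, t j) t • o.elim y fun j => D.simpleReflection j y := by
    simp only [Fintype.sum_option, Option.elim, simpleReflection_apply, smul_sub, smul_smul,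
      Finset.sum_sub_distrib, ← Finset.sum_smul, lowering_apply]
    module
  rw [hcomb]
  refine (convex_convexHull ℝ _).sum_mem ?_ ?_ ?_
  · rintro (_ | j) -
    exacts [sub_nonneg.2 hsum, ht j]
  · simp [Fintype.sum_option]
  · rintro (_ | j) -
    exacts [hy, simpleReflection_mem_orbitHull hy j]

omit [DecidableEq ι] in
theorem continuous_root_lowering_indicator (x : D.Cartan) (J : Finset ι) (j : ι) :
    Continuous fun d => D.root j (D.lowering x ((J : Set ι).indicator d)) := by
  refine (D.continuous_root_lowering x j).comp (continuous_pi fun i => ?_)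
  by_cases hi : i ∈ J
  · simpa [hi] using continuous_apply i
  · simpa [hi] using continuous_const

omit [DecidableEq ι] in
theorem tendsto_sum_sub_indicator_div_root (hcJ : ∀ j ∉ J, c j = 0)
    (hroot : ∀ j ∉ J, D.root j (D.lowering h ((J : Set ι).indicator c)) ≠ 0) :
    Filter.Tendsto (fun d => ∑ j, (d - (J : Set ι).indicator d) j /
      D.root j (D.lowering h ((J : Set ι).indicator d))) (𝓝 c) (𝓝 0) := by
  rw [← Finset.sum_const_zero (s := (Finset.univ : Finset ι))]
  refine tendsto_finsetSum _ fun j _ => ?_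
  by_cases hj : j ∈ J
  · simp [hj]
  · have hlim := (continuous_apply j).continuousAt.div (a := c)
      (continuous_root_lowering_indicator h J j).continuousAt (hroot j hj)
    simpa [ContinuousAt, Pi.div_def, hj, hcJ j hj] using hlim

end Faces

/-- `lowering h c` is interior to its face of the orthant; a nearby point is obtained from its
projection to this face by averaging with reflections. -/
theorem eventually_lowering_mem_orbitHull (hh : h ∈ D.openChamber) (hπ : D.IsCorootCoord π)
    (hc : 0 ≤ c) (hx : D.lowering h c ∈ D.closedChamber) :
    ∀ᶠ d in 𝓝 c, 0 ≤ d → D.lowering h d ∈ D.orbitHull h := by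
  obtain ⟨J, hJ⟩ : ∃ J : Finset ι, ∀ j, j ∈ J ↔ 0 < c j :=
    ⟨Finset.univ.filter _, Finset.mem_filter_univ⟩
  have hcJ : ∀ j ∉ J, c j = 0 := fun j hj => (hc j).antisymm' (not_lt.1 (mt (hJ j).2 hj))
  have hself : (J : Set ι).indicator c = c :=
    Set.indicator_eq_self.2 fun i hi => not_imp_comm.1 (hcJ i) hi
  have hroot : ∀ j ∉ J, 0 < D.root j (D.lowering h ((J : Set ι).indicator c)) := fun j hj => by
    rw [hself]
    exact (hh j).trans_le (D.root_le_root_lowering hc (hcJ j hj))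
  have hroot_near : ∀ᶠ d in 𝓝 c, ∀ j, j ∉ J →
      0 < D.root j (D.lowering h ((J : Set ι).indicator d)) :=
    Filter.eventually_all.2 fun j => Filter.eventually_imp_distrib_left.2 fun hj =>
      (continuous_root_lowering_indicator h J j).continuousAt.eventually_const_lt (hroot j hj)
  filter_upwards [hroot_near,
    eventually_lowering_indicator_mem_orbitHull hh hπ (fun j => (hJ j).1) hcJ hx,
    (tendsto_sum_sub_indicator_div_root hcJ fun j hj => (hroot j hj).ne').eventually_le_const
      one_pos] with d hd_root hd_mem hd_sum hd
  have hmem := lowering_mul_root_mem_orbitHull hd_mem (fun j => ?_) hd_sum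
  · convert hmem using 1
    have hmul : (fun j => (d - (J : Set ι).indicator d) j /
        D.root j (D.lowering h ((J : Set ι).indicator d)) *
        D.root j (D.lowering h ((J : Set ι).indicator d))) = d - (J : Set ι).indicator d := by
      ext j
      by_cases hj : j ∈ J
      · simp [hj]
      · exact div_mul_cancel₀ _ (hd_root j hj).ne'
    rw [hmul, lowering_lowering, add_sub_cancel]
  · by_cases hj : j ∈ J
    · simp [hj]
    · simpa [hj] using div_nonneg (hd j) (hd_root j hj).le

theorem preimage_orbit_subset_Ici (hπ : D.IsCorootCoord π) (hx : x ∈ D.dominated h) :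
    (D.lowering h ⁻¹' Set.range fun w => D.weylRep w x) ⊆ Set.Ici 0 := by
  rintro c ⟨w, hw⟩
  obtain ⟨d, hd, hdw⟩ := hx w
  rwa [← hπ.lowering_injective h (hdw.trans hw)]

/-- A point of least height in the closure of the orbit is dominant, since reflections preserve
this closure. -/
theorem exists_mem_closure_orbit_mem_closedChamber (hπ : D.IsCorootCoord π)
    (hx : x ∈ D.dominated h) :
    ∃ c ∈ closure (D.lowering h ⁻¹' Set.range fun w => D.weylRep w x),
      0 ≤ c ∧ D.lowering h c ∈ D.closedChamber := by
  set S := D.lowering h ⁻¹' Set.range fun w => D.weylRep w x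
  have hS : S ⊆ Set.Ici 0 := preimage_orbit_subset_Ici hπ hx
  have hS_nonempty : S.Nonempty := by
    obtain ⟨c, -, hc⟩ := exists_nonneg_lowering_eq hx
    exact ⟨c, 1, by simpa using hc.symm⟩
  obtain ⟨c, hc, hmin⟩ := exists_mem_closure_forall_sum_le hS_nonempty hS
  refine ⟨c, hc, closure_minimal hS isClosed_Ici hc, fun j => ?_⟩
  have hmaps : Set.MapsTo (fun d => d + Pi.single j (D.root j (D.lowering h d))) S S := by
    rintro d ⟨w, hw⟩
    refine ⟨D.coxeterSystem.simple j * w, ?_⟩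
    rw [← simpleReflection_lowering, ← hw, ← weylRep_simple]
    exact weylRep_mul_apply D _ w x
  have hcont : Continuous fun d => d + Pi.single j (D.root j (D.lowering h d)) :=
    continuous_id.add ((continuous_single j).comp (D.continuous_root_lowering h j))
  have hle := hmin _ (hmaps.closure hcont hc)
  simpa [Finset.sum_add_distrib] using hle

theorem orbitHull_eq_dominated (hh : h ∈ D.openChamber) (hπ : D.IsCorootCoord π) :
    D.orbitHull h = D.dominated h := by
  refine (orbitHull_subset_dominated (D.openChamber_subset_closedChamber hh)).antisymm
    fun x hx => ?_
  obtain ⟨c, hclosure, hc, hcx⟩ := exists_mem_closure_orbit_mem_closedChamber hπ hx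
  obtain ⟨d, ⟨hdS, hd⟩⟩ := ((mem_closure_iff_frequently.1 hclosure).and_eventually
    (eventually_lowering_mem_orbitHull hh hπ hc hcx)).exists
  obtain ⟨w, hw⟩ := hdS
  have hxd := hd (preimage_orbit_subset_Ici hπ hx ⟨w, hw⟩)
  rw [← hw] at hxd
  simpa only [Representation.inv_self_apply] using weylRep_mem_orbitHull hxd w⁻¹

section Basis

variable {κ : Type*} {𝓑 : Module.Basis (ι ⊕ κ) ℝ D.Cartan}

theorem isCorootCoord_pi_coord (h𝓑 : ∀ i, 𝓑 (Sum.inl i) = D.coroot i) :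
    D.IsCorootCoord (LinearMap.pi fun i => 𝓑.coord (Sum.inl i)) := by
  intro j
  ext i
  simp [← h𝓑, Finsupp.single_apply_left Sum.inl_injective, Finsupp.single_eq_pi_single]

omit [DecidableEq ι] in
theorem coord_inr_coroot (h𝓑 : ∀ i, 𝓑 (Sum.inl i) = D.coroot i) (k : κ) (j : ι) :
    𝓑.coord (Sum.inr k) (D.coroot j) = 0 := by
  simp [← h𝓑]

theorem coord_inr_weylRep (h𝓑 : ∀ i, 𝓑 (Sum.inl i) = D.coroot i) (k : κ) (w : D.WeylGroup)
    (x : D.Cartan) : 𝓑.coord (Sum.inr k) (D.weylRep w x) = 𝓑.coord (Sum.inr k) x := by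
  induction w using D.coxeterSystem.simple_induction_left with
  | one => simp
  | mul_simple_left w j ih =>
    rw [weylRep_mul_apply, weylRep_simple, simpleReflection_apply, map_sub, map_smul,
      coord_inr_coroot h𝓑, smul_zero, sub_zero, ih]

omit [DecidableEq ι] in
theorem mem_lowering_image_Ici_iff (h𝓑 : ∀ i, 𝓑 (Sum.inl i) = D.coroot i) :
    x ∈ D.lowering h '' Set.Ici 0 ↔ (∀ i, 𝓑.coord (Sum.inl i) x ≤ 𝓑.coord (Sum.inl i) h) ∧
      ∀ k, 𝓑.coord (Sum.inr k) x = 𝓑.coord (Sum.inr k) h := by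
  classical
  have coord_inl : ∀ c i, 𝓑.coord (Sum.inl i) (D.lowering h c) = 𝓑.coord (Sum.inl i) h - c i :=
    fun c => congrFun ((isCorootCoord_pi_coord h𝓑).map_lowering h c)
  have coord_inr : ∀ c k, 𝓑.coord (Sum.inr k) (D.lowering h c) = 𝓑.coord (Sum.inr k) h :=
    fun c k => by simp [lowering_apply, coord_inr_coroot h𝓑, -Module.Basis.coord_apply]
  constructor
  · rintro ⟨c, hc, rfl⟩
    exact ⟨fun i => (coord_inl c i).trans_le (sub_le_self _ (hc i)), coord_inr c⟩
  · rintro ⟨hle, heq⟩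
    refine ⟨fun i => 𝓑.coord (Sum.inl i) h - 𝓑.coord (Sum.inl i) x,
      fun i => sub_nonneg.2 (hle i), 𝓑.ext_elem ?_⟩
    rintro (i | k)
    · exact (coord_inl _ i).trans (sub_sub_cancel _ _)
    · exact (coord_inr _ k).trans (heq k).symm

end Basis

end KacMoodyRootDatum

end

theorem mainTheorem6_general {ι κ : Type*} [Fintype ι] [DecidableEq ι]
    {Λ : Type*} [AddCommGroup Λ] [Module.Free ℤ Λ] [Module.Finite ℤ Λ]
    (D : KacMoodyRootDatum ι Λ)
    (𝓑 : Module.Basis (ι ⊕ κ) ℝ D.Cartan) (h𝓑 : ∀ i, 𝓑 (Sum.inl i) = D.coroot i)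
    (h : D.Cartan) (hC : h ∈ D.openChamber) (h' : D.Cartan) :
    h' ∈ D.orbitHull h ↔
      (∀ (w : D.WeylGroup) (i : ι),
        𝓑.coord (Sum.inl i) (D.weylRep w h') ≤ 𝓑.coord (Sum.inl i) h) ∧
      (∀ k : κ, 𝓑.coord (Sum.inr k) h' = 𝓑.coord (Sum.inr k) h) := by
  rw [KacMoodyRootDatum.orbitHull_eq_dominated hC
    (KacMoodyRootDatum.isCorootCoord_pi_coord h𝓑)]
  simp only [KacMoodyRootDatum.dominated, Set.mem_ofPred_eq,
    KacMoodyRootDatum.mem_lowering_image_Ici_iff h𝓑,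
    KacMoodyRootDatum.coord_inr_weylRep h𝓑, forall_and, forall_const]

theorem mainTheorem6 {ι κ : Type*} [Fintype ι] [DecidableEq ι]
    {Λ : Type*} [AddCommGroup Λ] [Module.Free ℤ Λ] [Module.Finite ℤ Λ]
    (D : KacMoodyRootDatum ι Λ) (hsymm : IsSymmetrizable D.A)
    (hfree : D.IsFree) (hcofree : D.IsCofree)
    -- a basis of `𝔞` extending the simple coroots; `ω i = 𝓑.coord (inl i)` and
    -- `φ k = 𝓑.coord (inr k)` make up the dual basis
    (𝓑 : Module.Basis (ι ⊕ κ) ℝ D.Cartan) (h𝓑 : ∀ i, 𝓑 (Sum.inl i) = D.coroot i)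
    (h : D.Cartan) (hC : h ∈ D.openChamber) (h' : D.Cartan) :
    h' ∈ D.orbitHull h ↔
      (∀ (w : D.WeylGroup) (i : ι),
        𝓑.coord (Sum.inl i) (D.weylRep w h') ≤ 𝓑.coord (Sum.inl i) h) ∧
      (∀ k : κ, 𝓑.coord (Sum.inr k) h' = 𝓑.coord (Sum.inr k) h) :=
  mainTheorem6_general D 𝓑 h𝓑 h hC h'
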